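/- Let $k$ be a field, let $K$ be a finite abstract simplicial complex with faces among the subsets of $\{x_1,\dots,x_n\}$ (with $\varnothing\in K$), and let $R=R_K=k[x_1,\dots,x_n]/I_K$ be its face ring, where $I_K$ is generated by the square-free monomials $\prod_{x_i\in\sigma}x_i$ with $\sigma\subseteq\{x_1,\dots,x_n\}$, $\sigma\notin K$. For $\sigma\in K$ let $st(\sigma)=\{\tau\in K\mid\tau\cup\sigma\in K\}$ be its closed star and let $I_{st(\sigma)}\subseteq R$ be the image in $R$ of the face ideal of $st(\sigma)$. Let $D(R)=\bigcup_{m\ge0}D^m(R)\subseteq\mathrm{End}_k(R)$ be the ring of $k$-linear differential operators on $R$, where $D^0(R)=R$ (acting by multiplication) and $D^{m}(R)=\{\phi\in\mathrm{End}_k(R)\mid[\phi,r]\in D^{m-1}(R)\text{ for all }r\in R\}$ for $m>0$. An ideal $I\subseteq R$ is called $D(R)$-stable if $D(R)\bullet I=I$, where $D(R)\bullet I$ is the set of finite sums of elements $\phi(f)$ with $\phi\in D(R)$, $f\in I$. Theorem. 1. The (left) $D(R)$-submodules of $R$ are exactly the $D(R)$-stable ideals of $R$. 2. An ideal of $R$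 is $D(R)$-stable if and only if it is $R$ itself (the empty intersection) or is obtained from the ideals $I_{st(\sigma)}$, $\sigma\in K$, by repeatedly forming finite sums and intersections, i.e. it belongs to the smallest set of ideals of $R$ that contains all $I_{st(\sigma)}$ and is closed under $(I,J)\mapsto I+J$ and $(I,J)\mapsto I\cap J$. 3. (Traves) An ideal of $R$ is $D(R)$-stable if and only if it is an intersection of sums of minimal primes of $R$, that is, $I=\bigcap_{P\in\mathcal P}\sum_{\mathfrak p\in P}\mathfrak p$ for some set $\mathcal P$ of nonempty sets of minimal primes of $R$ (where the empty intersection is $R$). -/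

import Mathlib

namespace StanleyReisner

section DifferentialOperators

variable (k R : Type*) [Field k] [CommRing R] [Algebra k R]

/-- `diffOpLE k R n` is the set `D_k^n(R)` of `k`-linear differential operators of order at most
`n`: `D_k^0(R)` is `R`, acting on itself by multiplication, and an endomorphism `φ` lies in
`D_k^{n+1}(R)` when every commutator `[φ, r]`, `r ∈ R`, lies in `D_k^n(R)`. -/
def diffOpLE : ℕ → Set (Module.End k R)
  | 0 => Set.range fun r : R => LinearMap.mulLeft k r
  | n + 1 => {φ | ∀ r : R,
      φ * LinearMap.mulLeft k r - LinearMap.mulLeft k r * φ ∈ diffOpLE n}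

variable {k R}

theorem diffOpLE_zero_mem (n : ℕ) : (0 : Module.End k R) ∈ diffOpLE k R n := by
  induction n with
  | zero => exact ⟨0, by ext; simp⟩
  | succ n ih => intro r; simpa using ih

theorem diffOpLE_mono_succ (n : ℕ) : diffOpLE k R n ⊆ diffOpLE k R (n + 1) := by
  induction n with
  | zero =>
    rintro _ ⟨s, rfl⟩ r
    have h : LinearMap.mulLeft k s * LinearMap.mulLeft k r
        - LinearMap.mulLeft k r * LinearMap.mulLeft k s = 0 := by
      ext x; simp [mul_left_comm]
    simpa [h] using diffOpLE_zero_mem (k := k) (R := R) 0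
  | succ n ih => intro φ hφ r; exact ih (hφ r)

theorem diffOpLE_mono {m n : ℕ} (h : m ≤ n) : diffOpLE k R m ⊆ diffOpLE k R n :=
  monotone_nat_of_le_succ (f := diffOpLE k R) diffOpLE_mono_succ h

theorem diffOpLE_add (n : ℕ) {φ ψ : Module.End k R}
    (hφ : φ ∈ diffOpLE k R n) (hψ : ψ ∈ diffOpLE k R n) : φ + ψ ∈ diffOpLE k R n := by
  induction n generalizing φ ψ with
  | zero =>
    obtain ⟨a, rfl⟩ := hφ
    obtain ⟨b, rfl⟩ := hψ
    exact ⟨a + b, by ext; simp [add_mul]⟩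
  | succ n ih =>
    intro r
    have h := ih (hφ r) (hψ r)
    have e : (φ + ψ) * LinearMap.mulLeft k r - LinearMap.mulLeft k r * (φ + ψ)
        = (φ * LinearMap.mulLeft k r - LinearMap.mulLeft k r * φ)
          + (ψ * LinearMap.mulLeft k r - LinearMap.mulLeft k r * ψ) := by noncomm_ring
    rw [e]; exact h

theorem diffOpLE_mul {m n : ℕ} {φ ψ : Module.End k R}
    (hφ : φ ∈ diffOpLE k R m) (hψ : ψ ∈ diffOpLE k R n) : φ * ψ ∈ diffOpLE k R (m + n) := by
  suffices H : ∀ N m n, m + n = N → ∀ φ ψ : Module.End k R, φ ∈ diffOpLE k R m →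
      ψ ∈ diffOpLE k R n → φ * ψ ∈ diffOpLE k R N from H _ m n rfl φ ψ hφ hψ
  clear hφ hψ φ ψ m n
  intro N
  induction N with
  | zero =>
    intro m n hmn φ ψ hφ hψ
    obtain ⟨rfl, rfl⟩ : m = 0 ∧ n = 0 := by omega
    obtain ⟨a, rfl⟩ := hφ
    obtain ⟨b, rfl⟩ := hψ
    exact ⟨a * b, by ext; simp⟩
  | succ N ih =>
    intro m n hmn φ ψ hφ hψ r
    have e : φ * ψ * LinearMap.mulLeft k r - LinearMap.mulLeft k r * (φ * ψ)
        = φ * (ψ * LinearMap.mulLeft k r - LinearMap.mulLeft k r * ψ)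
          + (φ * LinearMap.mulLeft k r - LinearMap.mulLeft k r * φ) * ψ := by
      simp only [mul_sub, sub_mul, mul_assoc]; abel
    rw [e]
    have comm0 : ∀ χ : Module.End k R, χ ∈ diffOpLE k R 0 →
        χ * LinearMap.mulLeft k r - LinearMap.mulLeft k r * χ = 0 := by
      rintro _ ⟨s, rfl⟩
      ext x; simp [mul_left_comm]
    apply diffOpLE_add
    · cases n with
      | zero => rw [comm0 ψ hψ, mul_zero]; exact diffOpLE_zero_mem N
      | succ n => exact ih m n (by omega) _ _ hφ (hψ r)
    · cases m with
      | zero => rw [comm0 φ hφ, zero_mul]; exact diffOpLE_zero_mem N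
      | succ m => exact ih m n (by omega) _ _ (hφ r) hψ

variable (k R)

/-- The ring `D_k(R) = ⋃ₙ D_k^n(R)` of `k`-linear differential operators on `R`, as a subalgebra
of `End_k(R)`. -/
def diffOps : Subalgebra k (Module.End k R) where
  carrier := ⋃ n, diffOpLE k R n
  mul_mem' := by
    intro φ ψ hφ hψ
    obtain ⟨m, hm⟩ := Set.mem_iUnion.1 hφ
    obtain ⟨n, hn⟩ := Set.mem_iUnion.1 hψ
    exact Set.mem_iUnion.2 ⟨m + n, diffOpLE_mul hm hn⟩
  add_mem' := by
    intro φ ψ hφ hψ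
    obtain ⟨m, hm⟩ := Set.mem_iUnion.1 hφ
    obtain ⟨n, hn⟩ := Set.mem_iUnion.1 hψ
    exact Set.mem_iUnion.2 ⟨max m n, diffOpLE_add _ (diffOpLE_mono (le_max_left m n) hm)
      (diffOpLE_mono (le_max_right m n) hn)⟩
  algebraMap_mem' := by
    intro c
    exact Set.mem_iUnion.2 ⟨0, algebraMap k R c, by
      ext x; simp [Algebra.smul_def]⟩

variable {R}

/-- An ideal `I` of `R` is `D(R)`-stable when `D(R) • I = I`, where `D(R) • I` is the additive
group of finite sums of elements `φ(f)` with `φ ∈ D(R)` and `f ∈ I`. -/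
def IsDStable (I : Ideal R) : Prop :=
  AddSubgroup.closure {g : R | ∃ φ ∈ diffOps k R, ∃ f ∈ I, φ f = g} = I.toAddSubgroup

end DifferentialOperators

section FaceRings

variable {V : Type*}

/-- The faces of a simplicial complex, the empty face included. (Mathlib's complexes list only the
nonempty faces.) -/
def IsFace (K : PreAbstractSimplicialComplex V) (σ : Finset V) : Prop :=
  σ = ∅ ∨ σ ∈ K

/-- The closed star `st(σ, K) = {τ ∈ K | τ ∪ σ ∈ K}`. -/
def star [DecidableEq V] (K : PreAbstractSimplicialComplex V) (σ : Finset V) :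
    PreAbstractSimplicialComplex V where
  faces := {τ | τ ∈ K ∧ IsFace K (τ ∪ σ)}
  isRelLowerSet_faces := by
    rintro τ ⟨hτ, hτσ⟩
    refine ⟨(K.isRelLowerSet_faces hτ).1, fun ρ hρτ hρ => ?_⟩
    refine ⟨(K.isRelLowerSet_faces hτ).2 hρτ hρ, Or.inr ?_⟩
    rcases hτσ with h | h
    · exact absurd (Finset.union_eq_empty.1 h).1 (K.isRelLowerSet_faces hτ).1.ne_empty
    · exact (K.isRelLowerSet_faces h).2 (Finset.union_subset_union_left hρτ)
        (hρ.mono Finset.subset_union_left)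

variable (k : Type*) [Field k]

/-- The face ideal `I_K` in `k[x_v | v ∈ V]`: it is generated by the square-free monomials
`∏ v ∈ σ, x_v` with `σ` not a face of `K`. -/
noncomputable def faceIdeal (K : PreAbstractSimplicialComplex V) : Ideal (MvPolynomial V k) :=
  Ideal.span {m | ∃ σ : Finset V, ¬ IsFace K σ ∧ m = ∏ v ∈ σ, MvPolynomial.X v}

/-- The face ring (Stanley-Reisner ring) `R_K = k[x_v | v ∈ V] / I_K`. -/
abbrev FaceRing (K : PreAbstractSimplicialComplex V) : Type _ :=
  MvPolynomial V k ⧸ faceIdeal k K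

/-- The ideal `I_L` regarded in the face ring `R_K`, for a subcomplex `L` of `K`: the image of the
face ideal of `L`. -/
noncomputable def faceIdealIn (K L : PreAbstractSimplicialComplex V) : Ideal (FaceRing k K) :=
  (faceIdeal k L).map (Ideal.Quotient.mk (faceIdeal k K))

end FaceRings

end StanleyReisner

/-! Stars give stable ideals: whether a monomial vanishes in `R` depends only on its support, so
`I_{st(σ)}` annihilates `x^σ` and is the full annihilator of each positive power of it. An operator
of order at most `n` sends the annihilator of `s` into that of `s ^ (n + 1)`, hence preserves
`I_{st(σ)}` (`isDStable_faceIdealIn_star`). Stability survives sums and intersections, and the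
minimal primes are the `I_{st(F)}` for facets `F`.

Conversely, `x^c ∂^[a]` preserves `I_K` as soon as every facet containing `supp c` contains `supp a`
(`monomialOp_mem_faceIdeal`), and then acts on `R`. Taking `c = a` shows that a stable ideal `I` is
spanned by monomials; in general `x^a ∈ I` forces `x^c ∈ I`. Therefore `I` is the intersection, over
faces `τ` with `x^τ ∉ I`, of the sums of the minimal primes of facets containing `τ`
(`IsDStable.eq_biInf_sSup`). Divided powers make this work in every characteristic. -/

namespace StanleyReisner

/-! ### Stable ideals and operators on quotients, for a general algebra -/

section DifferentialOperators

variable {k R : Type*} [Field k] [CommRing R] [Algebra k R]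

theorem mulLeft_mem_diffOpLE (r : R) (n : ℕ) : LinearMap.mulLeft k r ∈ diffOpLE k R n :=
  diffOpLE_mono (Nat.zero_le n) ⟨r, rfl⟩

theorem mem_diffOps {φ : Module.End k R} : φ ∈ diffOps k R ↔ ∃ n, φ ∈ diffOpLE k R n :=
  Set.mem_iUnion

theorem mulLeft_mem_diffOps (r : R) : LinearMap.mulLeft k r ∈ diffOps k R :=
  mem_diffOps.2 ⟨0, r, rfl⟩

theorem isDStable_iff {I : Ideal R} :
    IsDStable k I ↔ ∀ φ ∈ diffOps k R, ∀ f ∈ I, φ f ∈ I := by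
  constructor
  · intro h φ hφ f hf
    have : φ f ∈ I.toAddSubgroup := h ▸ AddSubgroup.subset_closure ⟨φ, hφ, f, hf, rfl⟩
    exact this
  · intro h
    apply le_antisymm
    · rw [AddSubgroup.closure_le]
      rintro _ ⟨φ, hφ, f, hf, rfl⟩
      exact h φ hφ f hf
    · intro f hf
      exact AddSubgroup.subset_closure ⟨1, one_mem _, f, hf, rfl⟩

theorem exists_submodule_coe_eq_iff (S : Set R) :
    (∃ N : Submodule (diffOps k R) R, (N : Set R) = S) ↔
      ∃ I : Ideal R, IsDStable k I ∧ (I : Set R) = S := by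
  constructor
  · rintro ⟨N, rfl⟩
    refine ⟨{ carrier := N, add_mem' := N.add_mem, zero_mem' := N.zero_mem,
              smul_mem' := fun r f hf => N.smul_mem ⟨_, mulLeft_mem_diffOps r⟩ hf }, ?_, rfl⟩
    rw [isDStable_iff]
    intro φ hφ f hf
    exact N.smul_mem ⟨φ, hφ⟩ hf
  · rintro ⟨I, hI, rfl⟩
    rw [isDStable_iff] at hI
    exact ⟨{ carrier := I, add_mem' := I.add_mem, zero_mem' := I.zero_mem,
              smul_mem' := fun φ f hf => hI φ.1 φ.2 f hf }, rfl⟩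

theorem isDStable_sSup {S : Set (Ideal R)} (h : ∀ I ∈ S, IsDStable k I) :
    IsDStable k (sSup S) := by
  rw [isDStable_iff]
  intro φ hφ f hf
  rw [sSup_eq_iSup'] at hf ⊢
  induction hf using Submodule.iSup_induction' with
  | mem I f hf => exact Submodule.mem_iSup_of_mem I (isDStable_iff.1 (h I I.2) φ hφ f hf)
  | zero => simp
  | add f g _ _ hf hg => rw [map_add]; exact add_mem hf hg

theorem isDStable_sInf {S : Set (Ideal R)} (h : ∀ I ∈ S, IsDStable k I) :
    IsDStable k (sInf S) := by
  rw [isDStable_iff]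
  intro φ hφ f hf
  rw [Submodule.mem_sInf] at hf ⊢
  exact fun I hI => isDStable_iff.1 (h I hI) φ hφ f (hf I hI)

theorem isDStable_top : IsDStable k (⊤ : Ideal R) :=
  isDStable_iff.2 fun _ _ _ _ => trivial

theorem IsDStable.sup {I J : Ideal R} (hI : IsDStable k I) (hJ : IsDStable k J) :
    IsDStable k (I ⊔ J) := by
  rw [← sSup_pair]
  exact isDStable_sSup (by rintro _ (rfl | rfl) <;> assumption)

theorem IsDStable.inf {I J : Ideal R} (hI : IsDStable k I) (hJ : IsDStable k J) :
    IsDStable k (I ⊓ J) := by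
  rw [← sInf_pair]
  exact isDStable_sInf (by rintro _ (rfl | rfl) <;> assumption)

/-- A differential operator of order at most `n` maps the annihilator of `s` into that of
`s ^ (n + 1)`. -/
theorem pow_mul_diffOp_eq_zero {s g : R} (hsg : s * g = 0) (n : ℕ) {φ : Module.End k R}
    (hφ : φ ∈ diffOpLE k R n) : s ^ (n + 1) * φ g = 0 := by
  induction n generalizing φ with
  | zero =>
    obtain ⟨r, rfl⟩ := hφ
    simp [mul_left_comm s r g, hsg]
  | succ n ih =>
    -- Since `s * g = 0`, the commutator `[φ, s]` sends `g` to `-s * φ g`.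
    have := ih (hφ s)
    simpa [hsg, ← mul_assoc, ← pow_succ] using this

/-- All powers of `s` have the same annihilator, so the growing exponent in `pow_mul_diffOp_eq_zero`
does no harm. -/
theorem isDStable_of_mem_iff_mul_eq_zero {s : R} {I : Ideal R}
    (h : ∀ n g, g ∈ I ↔ s ^ (n + 1) * g = 0) : IsDStable k I := by
  rw [isDStable_iff]
  intro φ hφ f hf
  obtain ⟨n, hn⟩ := mem_diffOps.1 hφ
  rw [h n]
  exact pow_mul_diffOp_eq_zero (by simpa using (h 0 f).1 hf) n hn

theorem diffOpLE_of_quotient {I : Ideal R} {n : ℕ} {φ : Module.End k R}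
    (hφ : φ ∈ diffOpLE k R n) {ψ : Module.End k (R ⧸ I)}
    (h : ∀ f, ψ (Ideal.Quotient.mk I f) = Ideal.Quotient.mk I (φ f)) :
    ψ ∈ diffOpLE k (R ⧸ I) n := by
  induction n generalizing φ ψ with
  | zero =>
    obtain ⟨r, rfl⟩ := hφ
    refine ⟨Ideal.Quotient.mk I r, LinearMap.ext fun f => ?_⟩
    obtain ⟨f, rfl⟩ := Ideal.Quotient.mk_surjective f
    simp [h]
  | succ n ih =>
    intro r
    obtain ⟨r, rfl⟩ := Ideal.Quotient.mk_surjective r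
    refine ih (hφ r) fun f => ?_
    simp [h, ← map_mul]

theorem exists_quotient_endomorphism {I : Ideal R} {φ : Module.End k R}
    (h : ∀ f ∈ I, φ f ∈ I) :
    ∃ ψ : Module.End k (R ⧸ I),
      ∀ f, ψ (Ideal.Quotient.mk I f) = Ideal.Quotient.mk I (φ f) := by
  let π : R →ₗ[k] R ⧸ I := (Ideal.Quotient.mkₐ k I).toLinearMap
  have hπ : ∀ f, π f = Ideal.Quotient.mk I f := fun _ => rfl
  -- A `k`-linear section suffices: it moves representatives only by elements of `I`, which `φ`
  -- keeps in `I`.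
  obtain ⟨s, hs⟩ := π.exists_rightInverse_of_surjective
    (LinearMap.range_eq_top.2 Ideal.Quotient.mk_surjective)
  refine ⟨π ∘ₗ φ ∘ₗ s, fun f => ?_⟩
  have hf : s (Ideal.Quotient.mk I f) - f ∈ I := by
    rw [← Ideal.Quotient.eq, ← hπ]
    exact LinearMap.congr_fun hs _
  simpa [hπ, Ideal.Quotient.eq] using h _ hf

/-- The preimage of a stable ideal of `R / I` is preserved by the operators that preserve `I`. -/
theorem IsDStable.map_mem_comap {I : Ideal R} {J : Ideal (R ⧸ I)} (hJ : IsDStable k J)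
    {φ : Module.End k R} (hφ : φ ∈ diffOps k R) (h : ∀ f ∈ I, φ f ∈ I) {f : R}
    (hf : Ideal.Quotient.mk I f ∈ J) : Ideal.Quotient.mk I (φ f) ∈ J := by
  obtain ⟨n, hn⟩ := mem_diffOps.1 hφ
  obtain ⟨ψ, hψ⟩ := exists_quotient_endomorphism h
  rw [← hψ]
  exact isDStable_iff.1 hJ ψ (mem_diffOps.2 ⟨n, diffOpLE_of_quotient hn hψ⟩) _ hf

end DifferentialOperators

end StanleyReisner

/-! ### Divided-power monomial operators on the polynomial ring -/

namespace StanleyReisner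

section MonomialOperators

open MvPolynomial

variable {k V : Type*} [Field k]

theorem linearMap_ext_monomial {φ ψ : Module.End k (MvPolynomial V k)}
    (h : ∀ d, φ (monomial d 1) = ψ (monomial d 1)) : φ = ψ :=
  (basisMonomials V k).ext fun d => by simpa using h d

/-- It suffices to test commutators with the variables. -/
theorem mem_diffOpLE_succ_of_X {n : ℕ} {φ : Module.End k (MvPolynomial V k)}
    (h : ∀ v, φ * LinearMap.mulLeft k (X v) - LinearMap.mulLeft k (X v) * φ
      ∈ diffOpLE k (MvPolynomial V k) n) : φ ∈ diffOpLE k (MvPolynomial V k) (n + 1) := by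
  intro r
  induction r using MvPolynomial.induction_on with
  | C r =>
    have : φ * LinearMap.mulLeft k (C r) - LinearMap.mulLeft k (C r) * φ = 0 := by
      refine LinearMap.ext fun d => ?_
      simp [C_mul']
    rw [this]
    exact diffOpLE_zero_mem n
  | add p q hp hq =>
    convert diffOpLE_add n hp hq using 1
    have : LinearMap.mulLeft k (p + q) = LinearMap.mulLeft k p + LinearMap.mulLeft k q := by
      exact LinearMap.ext fun f => by simp [add_mul]
    rw [this]
    noncomm_ring
  | mul_X p v hp =>
    -- Leibniz rule: `[φ, p x_v] = p [φ, x_v] + [φ, p] x_v`.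
    have hl := diffOpLE_mul (mulLeft_mem_diffOpLE p 0) (h v)
    have hr := diffOpLE_mul hp (mulLeft_mem_diffOpLE (X v) 0)
    rw [zero_add] at hl
    convert diffOpLE_add n hl hr using 1
    rw [LinearMap.mulLeft_mul, ← Module.End.mul_eq_comp]
    simp only [mul_sub, sub_mul, mul_assoc]
    abel

variable [Fintype V]

/-- The operator `x ^ c * ∂ ^ [a]` on `k[x_v | v ∈ V]`, where `∂ ^ [a]` is the divided power of the
partial derivatives: it sends `x ^ d` to `∏ v, (d v).choose (a v) * x ^ (d - a + c)`. -/
noncomputable def monomialOp (k : Type*) [Field k] (a c : V →₀ ℕ) :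
    Module.End k (MvPolynomial V k) :=
  (basisMonomials V k).constr k fun d =>
    monomial (d - a + c) (((∏ v, (d v).choose (a v) : ℕ) : k))

theorem monomialOp_monomial (a c d : V →₀ ℕ) (r : k) :
    monomialOp k a c (monomial d r)
      = monomial (d - a + c) (r * ((∏ v, (d v).choose (a v) : ℕ) : k)) := by
  have h : monomial d r = r • basisMonomials V k d := by simp [smul_monomial]
  rw [h, map_smul, monomialOp, Module.Basis.constr_basis, smul_monomial, smul_eq_mul]

/-- A vanishing binomial coefficient makes the truncated subtraction `d - a` harmless. -/
theorem monomialOp_monomial_of_not_le {a d : V →₀ ℕ} (h : ¬ a ≤ d) (c : V →₀ ℕ) (r : k) :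
    monomialOp k a c (monomial d r) = 0 := by
  obtain ⟨v, hv⟩ : ∃ v, ¬ a v ≤ d v := by simpa [Finsupp.le_def] using h
  rw [monomialOp_monomial, Finset.prod_eq_zero (Finset.mem_univ v)
    (Nat.choose_eq_zero_of_lt (not_le.1 hv))]
  simp

theorem monomialOp_monomial_self (a c : V →₀ ℕ) (r : k) :
    monomialOp k a c (monomial a r) = monomial c r := by
  simp [monomialOp_monomial]

theorem monomialOp_zero (c : V →₀ ℕ) :
    monomialOp k 0 c = LinearMap.mulLeft k (monomial c (1 : k)) := by
  refine linearMap_ext_monomial fun d => ?_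
  simp [monomialOp_monomial, add_comm]

theorem monomialOp_commutator_X_of_eq_zero {a : V →₀ ℕ} {v : V} (hv : a v = 0) (c : V →₀ ℕ) :
    monomialOp k a c * LinearMap.mulLeft k (X v) - LinearMap.mulLeft k (X v) * monomialOp k a c
      = 0 := by
  classical
  refine linearMap_ext_monomial fun d => ?_
  have e : Finsupp.single v 1 + d - a + c = Finsupp.single v 1 + (d - a + c) := by
    ext w
    by_cases hw : w = v
    · subst hw; simp [hv, add_assoc]
    · simp [Ne.symm hw]
  have e' : ∏ w, ((Finsupp.single v 1 + d : V →₀ ℕ) w).choose (a w) = ∏ w, (d w).choose (a w) := by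
    refine Finset.prod_congr rfl fun w _ => ?_
    by_cases hw : w = v
    · subst hw; simp [hv]
    · simp [Ne.symm hw]
  simp only [LinearMap.sub_apply, Module.End.mul_apply,
    LinearMap.mulLeft_apply, X, monomial_mul, monomialOp_monomial, e, e', LinearMap.zero_apply]
  simp

/-- This is Pascal's rule in the variable `v`; it drives the induction on the order. -/
theorem monomialOp_commutator_X_add_single (a : V →₀ ℕ) (v : V) (c : V →₀ ℕ) :
    monomialOp k (a + Finsupp.single v 1) c * LinearMap.mulLeft k (X v)
        - LinearMap.mulLeft k (X v) * monomialOp k (a + Finsupp.single v 1) c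
      = monomialOp k a c := by
  classical
  refine linearMap_ext_monomial fun d => ?_
  have e : Finsupp.single v 1 + d - (a + Finsupp.single v 1) + c = d - a + c := by
    ext w; simp; omega
  have e' : ∏ w, ((Finsupp.single v 1 + d : V →₀ ℕ) w).choose ((a + Finsupp.single v 1 : V →₀ ℕ) w)
      = ∏ w, (d w).choose (a w) + ∏ w, (d w).choose ((a + Finsupp.single v 1 : V →₀ ℕ) w) := by
    rw [← Finset.mul_prod_erase _ _ (Finset.mem_univ v),
      ← Finset.mul_prod_erase _ (fun w => (d w).choose (a w)) (Finset.mem_univ v),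
      ← Finset.mul_prod_erase _ (fun w => (d w).choose ((a + Finsupp.single v 1 : V →₀ ℕ) w))
        (Finset.mem_univ v)]
    have h : ∀ f : V → ℕ, (∀ w, w ≠ v → f w = (d w).choose (a w)) →
        ∏ w ∈ Finset.univ.erase v, f w = ∏ w ∈ Finset.univ.erase v, (d w).choose (a w) :=
      fun f hf => Finset.prod_congr rfl fun w hw => hf w (Finset.ne_of_mem_erase hw)
    rw [h _ fun w hw => by simp [Ne.symm hw],
      h (fun w => (d w).choose ((a + Finsupp.single v 1 : V →₀ ℕ) w))
        fun w hw => by simp [Ne.symm hw], ← add_mul]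
    simp [add_comm 1, Nat.choose_succ_succ]
  simp only [LinearMap.sub_apply, Module.End.mul_apply,
    LinearMap.mulLeft_apply]
  have hX : (X v : MvPolynomial V k) * monomial d 1 = monomial (Finsupp.single v 1 + d) 1 := by
    simp [X, monomial_mul]
  rw [hX, monomialOp_monomial, e, e', monomialOp_monomial]
  by_cases hle : a + Finsupp.single v 1 ≤ d
  · rw [monomialOp_monomial, X, monomial_mul]
    have e'' : Finsupp.single v 1 + (d - (a + Finsupp.single v 1) + c) = d - a + c := by
      ext w
      have := hle w
      simp at this ⊢
      omega
    rw [e'', ← map_sub]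
    congr 1
    push_cast
    ring
  · obtain ⟨w, hw⟩ : ∃ w, ¬ (a + Finsupp.single v 1 : V →₀ ℕ) w ≤ d w := by
      simpa only [Finsupp.le_def, not_forall] using hle
    rw [monomialOp_monomial, Finset.prod_eq_zero (f := fun w => (d w).choose ((a + Finsupp.single v 1 : V →₀ ℕ) w))
      (Finset.mem_univ w) (Nat.choose_eq_zero_of_lt (not_le.1 hw))]
    simp

theorem monomialOp_mem_diffOpLE (n : ℕ) (a c : V →₀ ℕ) (ha : a.degree ≤ n) :
    monomialOp k a c ∈ diffOpLE k (MvPolynomial V k) n := by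
  induction n generalizing a with
  | zero =>
    obtain rfl : a = 0 := (Finsupp.degree_eq_zero_iff a).1 (Nat.le_zero.1 ha)
    exact ⟨_, (monomialOp_zero c).symm⟩
  | succ n ih =>
    refine mem_diffOpLE_succ_of_X fun v => ?_
    by_cases hv : a v = 0
    · rw [monomialOp_commutator_X_of_eq_zero hv]
      exact diffOpLE_zero_mem n
    · obtain ⟨b, rfl⟩ : ∃ b, a = b + Finsupp.single v 1 :=
        ⟨a - Finsupp.single v 1, (tsub_add_cancel_of_le (by simpa using Nat.one_le_iff_ne_zero.2 hv)).symm⟩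
      rw [monomialOp_commutator_X_add_single]
      exact ih b (by simpa using ha)

theorem monomialOp_mem_diffOps (a c : V →₀ ℕ) :
    monomialOp k a c ∈ diffOps k (MvPolynomial V k) :=
  mem_diffOps.2 ⟨_, monomialOp_mem_diffOpLE _ a c le_rfl⟩

/-- A subspace of the polynomial ring that is preserved by all operators `x ^ a * ∂ ^ [a]` is
spanned by monomials. -/
theorem monomial_mem_of_monomialOp_mem {M : Submodule k (MvPolynomial V k)}
    (h : ∀ a, ∀ f ∈ M, monomialOp k a a f ∈ M) {f : MvPolynomial V k} (hf : f ∈ M) :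
    ∀ d ∈ f.support, monomial d (1 : k) ∈ M := by
  induction hn : f.support.card generalizing f with
  | zero => simp [Finset.card_eq_zero.1 hn]
  | succ n ih =>
    -- The operator `x^a ∂^[a]` kills `x^d` unless `a ≤ d`, so for maximal `a` it isolates the term
    -- at `a`, which can then be subtracted.
    obtain ⟨a, ha⟩ := f.support.exists_maximal (Finset.card_pos.1 (by omega))
    have hop : monomialOp k a a f = monomial a (coeff a f) := by
      conv_lhs => rw [f.as_sum, map_sum]
      rw [Finset.sum_eq_single a, monomialOp_monomial_self]
      · intro d hd hda
        exact monomialOp_monomial_of_not_le (fun had => hda (ha.eq_of_le hd had).symm) _ _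
      · intro h; exact absurd ha.prop h
    have hmem := h a f hf
    rw [hop] at hmem
    have hne : coeff a f ≠ 0 := mem_support_iff.1 ha.prop
    have hone : monomial a (1 : k) ∈ M := by
      simpa [smul_monomial, hne] using M.smul_mem (coeff a f)⁻¹ hmem
    have hsupp : (f - monomial a (coeff a f)).support = f.support.erase a := by
      classical
      ext d
      by_cases hd : a = d
      · subst hd; simp
      · simp [hd, Ne.symm hd]
    intro d hd
    by_cases hda : d = a
    · rwa [hda]
    · refine ih (sub_mem hf hmem) ?_ d (by rw [hsupp]; exact Finset.mem_erase.2 ⟨hda, hd⟩)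
      rw [hsupp, Finset.card_erase_of_mem ha.prop, hn]
      rfl

end MonomialOperators

end StanleyReisner

/-! ### Monomial description of face ideals and stars -/

namespace StanleyReisner

section FaceRings

open MvPolynomial

variable {k V : Type*} [Field k] {K L : PreAbstractSimplicialComplex V}

theorem IsFace.mono {σ τ : Finset V} (hσ : IsFace K σ) (h : τ ⊆ σ) : IsFace K τ := by
  rcases τ.eq_empty_or_nonempty with rfl | hτ
  · exact Or.inl rfl
  · rcases hσ with rfl | hσ
    · exact absurd (Finset.subset_empty.1 h) hτ.ne_empty
    · exact Or.inr ((K.isRelLowerSet_faces hσ).2 h hτ)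

theorem isFace_star_iff [DecidableEq V] {σ τ : Finset V} (hσ : IsFace K σ) :
    IsFace (star K σ) τ ↔ IsFace K (τ ∪ σ) := by
  constructor
  · rintro (rfl | h)
    · simpa using hσ
    · exact h.2
  · intro h
    rcases h.mono Finset.subset_union_left with h' | h'
    · exact Or.inl h'
    · exact Or.inr ⟨h', h⟩

theorem isFace_star_iff_of_maximal [DecidableEq V] {F τ : Finset V} (hF : Maximal (IsFace K) F) :
    IsFace (star K F) τ ↔ τ ⊆ F := by
  rw [isFace_star_iff hF.prop]
  constructor
  · intro h
    exact Finset.subset_union_left.trans (hF.le_of_ge h Finset.subset_union_right)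
  · intro h
    rw [Finset.union_eq_right.2 h]
    exact hF.prop

theorem IsFace.exists_maximal [Finite V] {σ : Finset V} (hσ : IsFace K σ) :
    ∃ F, σ ⊆ F ∧ Maximal (IsFace K) F :=
  Finite.exists_le_maximal hσ

/-- The exponent of the square-free monomial `∏ v ∈ σ, x_v`. -/
noncomputable def sqfreeExp (σ : Finset V) : V →₀ ℕ :=
  ∑ v ∈ σ, Finsupp.single v 1

theorem sqfreeExp_apply [DecidableEq V] (σ : Finset V) (v : V) :
    sqfreeExp σ v = if v ∈ σ then 1 else 0 := by
  simp [sqfreeExp, Finsupp.finsetSum_apply, Finsupp.single_apply]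

theorem support_sqfreeExp (σ : Finset V) : (sqfreeExp σ).support = σ := by
  classical
  ext v
  simp [sqfreeExp_apply]

theorem sqfreeExp_le_iff {σ : Finset V} {d : V →₀ ℕ} : sqfreeExp σ ≤ d ↔ σ ⊆ d.support := by
  classical
  constructor
  · intro h
    simpa [support_sqfreeExp] using Finsupp.support_mono h
  · intro h v
    rw [sqfreeExp_apply]
    split_ifs with hv
    · exact Nat.one_le_iff_ne_zero.2 (Finsupp.mem_support_iff.1 (h hv))
    · exact Nat.zero_le _

theorem monomial_sqfreeExp (σ : Finset V) :
    monomial (sqfreeExp σ) (1 : k) = ∏ v ∈ σ, X v := by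
  rw [sqfreeExp, monomial_sum_one]
  rfl

theorem mem_faceIdeal_iff {f : MvPolynomial V k} :
    f ∈ faceIdeal k K ↔ ∀ d ∈ f.support, ¬ IsFace K d.support := by
  have : {m : MvPolynomial V k | ∃ σ : Finset V, ¬ IsFace K σ ∧ m = ∏ v ∈ σ, X v}
      = (fun d => monomial d (1 : k)) '' (sqfreeExp '' {σ | ¬ IsFace K σ}) := by
    ext m
    simp [monomial_sqfreeExp, eq_comm]
  rw [faceIdeal, this, mem_ideal_span_monomial_image]
  refine forall₂_congr fun d _ => ?_
  simp only [Set.exists_mem_image, sqfreeExp_le_iff]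
  exact ⟨fun ⟨σ, hσ, h⟩ hd => hσ (hd.mono h), fun h => ⟨_, h, subset_rfl⟩⟩

theorem monomial_mem_faceIdeal_iff {d : V →₀ ℕ} :
    monomial d (1 : k) ∈ faceIdeal k K ↔ ¬ IsFace K d.support := by
  classical
  simp [mem_faceIdeal_iff, support_monomial]

theorem faceIdeal_anti (h : ∀ σ, IsFace L σ → IsFace K σ) : faceIdeal k K ≤ faceIdeal k L := by
  intro f hf
  rw [mem_faceIdeal_iff] at hf ⊢
  exact fun d hd hL => hf d hd (h _ hL)

theorem isFace_of_isFace_star [DecidableEq V] {σ τ : Finset V} (h : IsFace (star K σ) τ) :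
    IsFace K τ :=
  h.imp id fun h => h.1

theorem mk_mem_faceIdealIn_iff (h : ∀ σ, IsFace L σ → IsFace K σ) {f : MvPolynomial V k} :
    Ideal.Quotient.mk (faceIdeal k K) f ∈ faceIdealIn k K L ↔ f ∈ faceIdeal k L :=
  Ideal.mem_quotient_iff_mem (faceIdeal_anti h)

/-- The ideal is the kernel of the substitution killing the variables outside `F`, whose target is a
domain. -/
theorem isPrime_faceIdeal {F : Finset V} (hL : ∀ τ, IsFace L τ ↔ τ ⊆ F) :
    (faceIdeal k L).IsPrime := by
  classical
  let g : MvPolynomial V k →ₐ[k] MvPolynomial V k := aeval fun v => if v ∈ F then X v else 0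
  have hg : ∀ f d, coeff d (g f) = if d.support ⊆ F then coeff d f else 0 := by
    intro f d
    induction f using MvPolynomial.induction_on' with
    | monomial e r =>
      by_cases he : e.support ⊆ F
      · have : g (monomial e r) = monomial e r := by
          rw [aeval_monomial, monomial_eq, algebraMap_eq]
          congr 1
          exact Finset.prod_congr rfl fun v hv => by simp [he hv]
        rw [this, coeff_monomial]
        by_cases hde : e = d
        · subst hde; simp [he]
        · simp [hde]
      · have : g (monomial e r) = 0 := by
          obtain ⟨v, hv, hvF⟩ := Finset.not_subset.1 he
          rw [aeval_monomial, Finsupp.prod, Finset.prod_eq_zero hv, mul_zero]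
          simp [hvF, Finsupp.mem_support_iff.1 hv]
        rw [this, coeff_monomial]
        by_cases hde : e = d
        · subst hde; simp [he]
        · simp [hde]
    | add p q hp hq => rw [map_add, coeff_add, hp, hq, coeff_add]; split_ifs <;> simp
  have : faceIdeal k L = RingHom.ker g := by
    ext f
    rw [RingHom.mem_ker, MvPolynomial.eq_zero_iff, mem_faceIdeal_iff]
    refine forall_congr' fun d => ?_
    rw [hg, hL, mem_support_iff]
    split_ifs with h <;> simp [h]
  rw [this]
  exact RingHom.ker_isPrime g

/-! ### Minimal primes and stability of star ideals -/

section DecidableEq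

variable [DecidableEq V]

theorem isPrime_faceIdealIn_star {F : Finset V} (hF : Maximal (IsFace K) F) :
    (faceIdealIn k K (star K F)).IsPrime := by
  have := isPrime_faceIdeal (k := k) fun τ => isFace_star_iff_of_maximal (τ := τ) hF
  refine Ideal.map_isPrime_of_surjective Ideal.Quotient.mk_surjective ?_
  rw [Ideal.mk_ker]
  exact faceIdeal_anti fun _ => isFace_of_isFace_star

theorem exists_faceIdealIn_star_le [Finite V] (Q : Ideal (FaceRing k K)) [hQ : Q.IsPrime] :
    ∃ F, Maximal (IsFace K) F ∧ faceIdealIn k K (star K F) ≤ Q := by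
  classical
  have := Fintype.ofFinite V
  -- By primality the product over `σ` is not in `Q`, so it is nonzero and `σ` is a face. Variables
  -- outside any facet containing `σ` lie in `Q`.
  let σ : Finset V := {v | Ideal.Quotient.mk (faceIdeal k K) (X v) ∉ Q}
  have hσ : IsFace K σ := by
    by_contra hσ
    have hmem : Ideal.Quotient.mk (faceIdeal k K) (∏ v ∈ σ, X v) ∈ Q := by
      have : ∏ v ∈ σ, X v ∈ faceIdeal k K := Ideal.subset_span ⟨σ, hσ, rfl⟩
      rw [Ideal.Quotient.eq_zero_iff_mem.2 this]
      exact Q.zero_mem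
    rw [map_prod, Ideal.IsPrime.prod_mem_iff] at hmem
    obtain ⟨v, hv, hvQ⟩ := hmem
    exact (Finset.mem_filter.1 hv).2 hvQ
  obtain ⟨F, hσF, hF⟩ := hσ.exists_maximal
  refine ⟨F, hF, ?_⟩
  rw [faceIdealIn, Ideal.map_le_iff_le_comap, faceIdeal, Ideal.span_le]
  rintro _ ⟨τ, hτ, rfl⟩
  rw [isFace_star_iff_of_maximal hF] at hτ
  obtain ⟨v, hv, hvF⟩ := Finset.not_subset.1 hτ
  have hvQ : Ideal.Quotient.mk (faceIdeal k K) (X v) ∈ Q := by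
    by_contra h
    exact hvF (hσF (Finset.mem_filter.2 ⟨Finset.mem_univ v, h⟩))
  exact Ideal.mem_of_dvd (Q.comap _) (Finset.dvd_prod_of_mem _ hv) hvQ

/-- The minimal primes of the face ring are the ideals of the stars of the facets. -/
theorem minimalPrimes_faceRing [Finite V] :
    minimalPrimes (FaceRing k K) =
      {P | ∃ F, Maximal (IsFace K) F ∧ P = faceIdealIn k K (star K F)} := by
  -- The monomial `x^F` lies in the prime of every facet other than `F`, but not in that of `F`.
  have key : ∀ F G, Maximal (IsFace K) F → Maximal (IsFace K) G →
      faceIdealIn k K (star K G) ≤ faceIdealIn k K (star K F) → F = G := by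
    intro F G hF hG h
    refine hF.eq_of_le hG.prop ?_
    by_contra hFG
    have h1 : Ideal.Quotient.mk (faceIdeal k K) (monomial (sqfreeExp F) 1)
        ∈ faceIdealIn k K (star K G) := by
      rw [mk_mem_faceIdealIn_iff fun _ => isFace_of_isFace_star, monomial_mem_faceIdeal_iff,
        isFace_star_iff_of_maximal hG, support_sqfreeExp]
      exact hFG
    have h2 := h h1
    rw [mk_mem_faceIdealIn_iff fun _ => isFace_of_isFace_star, monomial_mem_faceIdeal_iff,
      isFace_star_iff_of_maximal hF, support_sqfreeExp] at h2
    exact h2 subset_rfl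
  rw [minimalPrimes_eq_minimals]
  ext P
  constructor
  · intro hP
    have := hP.prop
    obtain ⟨F, hF, hle⟩ := exists_faceIdealIn_star_le P
    exact ⟨F, hF, hP.eq_of_ge (isPrime_faceIdealIn_star hF) hle⟩
  · rintro ⟨F, hF, rfl⟩
    refine ⟨isPrime_faceIdealIn_star hF, fun Q hQ hle => ?_⟩
    have : Q.IsPrime := hQ
    obtain ⟨G, hG, hGQ⟩ := exists_faceIdealIn_star_le Q
    obtain rfl := key F G hF hG (hGQ.trans hle)
    exact hGQ

/-- `I_{st(σ)}` is the annihilator of every positive power of `∏ v ∈ σ, x_v`. -/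
theorem mem_faceIdealIn_star_iff {σ : Finset V} (hσ : IsFace K σ) (n : ℕ) (g : FaceRing k K) :
    g ∈ faceIdealIn k K (star K σ) ↔
      Ideal.Quotient.mk (faceIdeal k K) (monomial (sqfreeExp σ) 1) ^ (n + 1) * g = 0 := by
  obtain ⟨f, rfl⟩ := Ideal.Quotient.mk_surjective g
  have hsupp : ∀ d : V →₀ ℕ, (((n + 1) • sqfreeExp σ) + d).support = d.support ∪ σ := by
    intro d
    ext v
    simp [sqfreeExp_apply]
    tauto
  rw [mk_mem_faceIdealIn_iff fun _ => isFace_of_isFace_star, ← map_pow, monomial_pow, one_pow,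
    ← map_mul, Ideal.Quotient.eq_zero_iff_mem, mem_faceIdeal_iff, mem_faceIdeal_iff]
  constructor
  · intro h e he
    rw [mem_support_iff, coeff_monomial_mul'] at he
    split_ifs at he with hle
    · rw [one_mul, ← mem_support_iff] at he
      have := h _ he
      rwa [isFace_star_iff hσ, ← hsupp, add_tsub_cancel_of_le hle] at this
    · exact absurd rfl he
  · intro h d hd
    rw [isFace_star_iff hσ, ← hsupp]
    apply h
    rw [mem_support_iff, coeff_monomial_mul', if_pos le_self_add, add_tsub_cancel_left, one_mul]
    exact mem_support_iff.1 hd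

theorem isDStable_faceIdealIn_star {σ : Finset V} (hσ : IsFace K σ) :
    IsDStable k (faceIdealIn k K (star K σ)) :=
  isDStable_of_mem_iff_mul_eq_zero (mem_faceIdealIn_star_iff hσ)

theorem isDStable_of_mem_minimalPrimes [Finite V] {P : Ideal (FaceRing k K)}
    (hP : P ∈ minimalPrimes (FaceRing k K)) : IsDStable k P := by
  rw [minimalPrimes_faceRing] at hP
  obtain ⟨F, hF, rfl⟩ := hP
  exact isDStable_faceIdealIn_star hF.prop

end DecidableEq

/-! ### Operators descending to the face ring, and the classification -/

/-- If the support of `d - a + c` lay in a facet `F`, then `F` would contain `supp c`, hence `supp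
a`, hence `supp d`, a nonface. -/
theorem monomialOp_mem_faceIdeal [Fintype V] {a c : V →₀ ℕ}
    (h : ∀ F, Maximal (IsFace K) F → c.support ⊆ F → a.support ⊆ F) {f : MvPolynomial V k}
    (hf : f ∈ faceIdeal k K) : monomialOp k a c f ∈ faceIdeal k K := by
  classical
  rw [mem_faceIdeal_iff] at hf
  rw [f.as_sum, map_sum]
  refine Ideal.sum_mem _ fun d hd => ?_
  by_cases hle : a ≤ d
  · rw [monomialOp_monomial, ← mul_one (coeff d f * _), ← C_mul_monomial]
    refine Ideal.mul_mem_left _ _ ?_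
    rw [monomial_mem_faceIdeal_iff]
    intro hface
    obtain ⟨F, hsub, hF⟩ := hface.exists_maximal
    refine hf d hd (hF.prop.mono ?_)
    have hc : c.support ⊆ F := (Finsupp.support_mono le_add_self).trans hsub
    have hda : (d - a).support ⊆ F := (Finsupp.support_mono le_self_add).trans hsub
    rw [← tsub_add_cancel_of_le hle]
    exact Finsupp.support_add.trans (Finset.union_subset hda (h F hF hc))
  · rw [monomialOp_monomial_of_not_le hle]
    exact Ideal.zero_mem _

theorem IsDStable.monomial_mem [Finite V] {I : Ideal (FaceRing k K)} (hI : IsDStable k I)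
    {f : MvPolynomial V k} (hf : Ideal.Quotient.mk (faceIdeal k K) f ∈ I) {d : V →₀ ℕ}
    (hd : d ∈ f.support) : Ideal.Quotient.mk (faceIdeal k K) (monomial d 1) ∈ I := by
  have := Fintype.ofFinite V
  let M : Submodule k (MvPolynomial V k) :=
    (I.comap (Ideal.Quotient.mk (faceIdeal k K))).restrictScalars k
  exact monomial_mem_of_monomialOp_mem (M := M)
    (fun a f hf => hI.map_mem_comap (monomialOp_mem_diffOps a a)
      (fun g hg => monomialOp_mem_faceIdeal (fun _ _ => id) hg) hf) hf d hd

theorem IsDStable.monomial_mem_of_facets [Finite V] {I : Ideal (FaceRing k K)}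
    (hI : IsDStable k I) {a c : V →₀ ℕ}
    (h : ∀ F, Maximal (IsFace K) F → c.support ⊆ F → a.support ⊆ F)
    (ha : Ideal.Quotient.mk (faceIdeal k K) (monomial a 1) ∈ I) :
    Ideal.Quotient.mk (faceIdeal k K) (monomial c 1) ∈ I := by
  have := Fintype.ofFinite V
  rw [← monomialOp_monomial_self a c]
  exact hI.map_mem_comap (monomialOp_mem_diffOps a c)
    (fun g hg => monomialOp_mem_faceIdeal h hg) ha

/-- The full simplex on the vertex set `τ`. -/
def simplex (τ : Finset V) : PreAbstractSimplicialComplex V where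
  faces := {σ | σ.Nonempty ∧ σ ⊆ τ}
  isRelLowerSet_faces := fun _ hσ => ⟨hσ.1, fun _ hρ hne => ⟨hne, hρ.trans hσ.2⟩⟩

theorem isFace_simplex_iff {σ τ : Finset V} : IsFace (simplex τ) σ ↔ σ ⊆ τ := by
  constructor
  · rintro (rfl | h)
    · exact Finset.empty_subset τ
    · exact h.2
  · intro h
    exact σ.eq_empty_or_nonempty.imp id fun hne => ⟨hne, h⟩

variable [DecidableEq V]

variable (k K) in
/-- The minimal primes of the face ring that belong to the facets containing `τ`. -/
def facetPrimes (τ : Finset V) : Set (Ideal (FaceRing k K)) :=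
  {P | ∃ F, Maximal (IsFace K) F ∧ τ ⊆ F ∧ P = faceIdealIn k K (star K F)}

theorem facetPrimes_subset_minimalPrimes [Finite V] (τ : Finset V) :
    facetPrimes k K τ ⊆ minimalPrimes (FaceRing k K) := by
  rintro _ ⟨F, hF, _, rfl⟩
  rw [minimalPrimes_faceRing]
  exact ⟨F, hF, rfl⟩

theorem IsFace.facetPrimes_nonempty [Finite V] {τ : Finset V} (hτ : IsFace K τ) :
    (facetPrimes k K τ).Nonempty := by
  obtain ⟨F, hτF, hF⟩ := hτ.exists_maximal
  exact ⟨_, F, hF, hτF, rfl⟩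

/-- The bound serves to show that no monomial with support a face `τ` lies in the sum. -/
theorem sSup_facetPrimes_le (τ : Finset V) :
    sSup (facetPrimes k K τ) ≤ faceIdealIn k K (simplex τ) := by
  refine sSup_le ?_
  rintro _ ⟨F, hF, hτF, rfl⟩
  refine Ideal.map_mono (faceIdeal_anti fun σ hσ => ?_)
  rw [isFace_star_iff_of_maximal hF]
  exact (isFace_simplex_iff.1 hσ).trans hτF

theorem isDStable_biInf_sSup [Finite V] {F : Set (Set (Ideal (FaceRing k K)))}
    (h : ∀ P ∈ F, P ⊆ minimalPrimes (FaceRing k K)) : IsDStable k (⨅ P ∈ F, sSup P) := by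
  rw [← sInf_image]
  refine isDStable_sInf ?_
  rintro _ ⟨P, hP, rfl⟩
  exact isDStable_sSup fun Q hQ => isDStable_of_mem_minimalPrimes (h P hP hQ)

theorem IsDStable.eq_biInf_sSup [Finite V] {I : Ideal (FaceRing k K)} (hI : IsDStable k I) :
    I = ⨅ P ∈ facetPrimes k K '' {τ | IsFace K τ ∧
      Ideal.Quotient.mk (faceIdeal k K) (monomial (sqfreeExp τ) 1) ∉ I}, sSup P := by
  have hJ := isDStable_biInf_sSup (k := k) (K := K) (F := facetPrimes k K '' {τ | IsFace K τ ∧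
      Ideal.Quotient.mk (faceIdeal k K) (monomial (sqfreeExp τ) 1) ∉ I}) (by
    rintro _ ⟨τ, _, rfl⟩
    exact facetPrimes_subset_minimalPrimes τ)
  have hsum : ∀ {J : Ideal (FaceRing k K)} {p : MvPolynomial V k},
      (∀ d ∈ p.support, Ideal.Quotient.mk (faceIdeal k K) (monomial d 1) ∈ J) →
        Ideal.Quotient.mk (faceIdeal k K) p ∈ J := by
    intro J p h
    rw [p.as_sum, map_sum]
    refine J.sum_mem fun d hd => ?_
    rw [← mul_one (coeff d p), ← C_mul_monomial, map_mul]
    exact J.mul_mem_left _ (h d hd)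
  apply le_antisymm
  · intro f hf
    obtain ⟨p, rfl⟩ := Ideal.Quotient.mk_surjective f
    refine hsum fun d hd => ?_
    have hdI := hI.monomial_mem hf hd
    simp only [Submodule.mem_iInf]
    rintro _ ⟨τ, ⟨_, hτI⟩, rfl⟩
    by_contra hd'
    -- If every facet containing `τ` contained `supp d`, then `x^d ∈ I` would give `x^τ ∈ I`. A
    -- facet violating this has `x^d` in its prime.
    refine hτI (hI.monomial_mem_of_facets (fun F hF hτF => ?_) hdI)
    rw [support_sqfreeExp] at hτF
    by_contra hdF
    have hFP : faceIdealIn k K (star K F) ∈ facetPrimes k K τ := ⟨F, hF, hτF, rfl⟩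
    refine hd' (le_sSup hFP ?_)
    rwa [mk_mem_faceIdealIn_iff fun _ => isFace_of_isFace_star, monomial_mem_faceIdeal_iff,
      isFace_star_iff_of_maximal hF]
  · intro f hf
    obtain ⟨p, rfl⟩ := Ideal.Quotient.mk_surjective f
    refine hsum fun d hd => ?_
    have hdJ := hJ.monomial_mem hf hd
    by_cases hface : IsFace K d.support
    · refine hI.monomial_mem_of_facets (a := sqfreeExp d.support)
        (fun F _ h => by rwa [support_sqfreeExp]) ?_
      by_contra hdI
      simp only [Submodule.mem_iInf] at hdJ
      have := sSup_facetPrimes_le _ (hdJ _ ⟨_, ⟨hface, hdI⟩, rfl⟩)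
      rw [mk_mem_faceIdealIn_iff fun σ hσ => hface.mono (isFace_simplex_iff.1 hσ),
        monomial_mem_faceIdeal_iff, isFace_simplex_iff] at this
      exact this subset_rfl
    · rw [Ideal.Quotient.eq_zero_iff_mem.2 (monomial_mem_faceIdeal_iff.2 hface)]
      exact I.zero_mem

theorem isDStable_iff_exists_biInf_sSup [Finite V] (I : Ideal (FaceRing k K)) :
    IsDStable k I ↔ ∃ F : Set (Set (Ideal (FaceRing k K))),
      (∀ P ∈ F, P.Nonempty ∧ P ⊆ minimalPrimes (FaceRing k K)) ∧ I = ⨅ P ∈ F, sSup P := by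
  constructor
  · intro hI
    refine ⟨_, ?_, hI.eq_biInf_sSup⟩
    rintro _ ⟨τ, hτ, rfl⟩
    exact ⟨hτ.1.facetPrimes_nonempty, facetPrimes_subset_minimalPrimes τ⟩
  · rintro ⟨F, hF, rfl⟩
    exact isDStable_biInf_sSup fun P hP => (hF P hP).2

theorem finite_minimalPrimes_faceRing [Finite V] : (minimalPrimes (FaceRing k K)).Finite := by
  rw [minimalPrimes_faceRing]
  refine (Set.finite_range fun F : Finset V => faceIdealIn k K (star K F)).subset ?_
  rintro _ ⟨F, _, rfl⟩
  exact ⟨F, rfl⟩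

theorem isDStable_iff_mem_latticeClosure [Finite V] (I : Ideal (FaceRing k K)) :
    IsDStable k I ↔ I = ⊤ ∨ I ∈ latticeClosure {J : Ideal (FaceRing k K) |
      ∃ σ : Finset V, IsFace K σ ∧ J = faceIdealIn k K (star K σ)} := by
  constructor
  · rw [isDStable_iff_exists_biInf_sSup]
    rintro ⟨F, hF, rfl⟩
    -- The lattice closure supplies only nonempty finite sums and intersections: the empty family
    -- gives `⊤`, and finiteness comes from the finitely many minimal primes.
    rcases F.eq_empty_or_nonempty with rfl | hne
    · simp
    · right
      have hfin : F.Finite :=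
        finite_minimalPrimes_faceRing.finite_subsets.subset fun P hP => (hF P hP).2
      refine isSublattice_latticeClosure.infClosed.biInf_mem_of_nonempty hfin hne fun P hP => ?_
      refine isSublattice_latticeClosure.supClosed.sSup_mem_of_nonempty
        (finite_minimalPrimes_faceRing.subset (hF P hP).2) (hF P hP).1 fun Q hQ => ?_
      have hQ' := (hF P hP).2 hQ
      rw [minimalPrimes_faceRing] at hQ'
      obtain ⟨G, hG, rfl⟩ := hQ'
      exact subset_latticeClosure ⟨G, hG.prop, rfl⟩
  · rintro (rfl | hI)
    · exact isDStable_top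
    · refine latticeClosure_min (t := {J | IsDStable k J}) ?_
        ⟨fun _ h _ h' => h.sup h', fun _ h _ h' => h.inf h'⟩ hI
      rintro _ ⟨σ, hσ, rfl⟩
      exact isDStable_faceIdealIn_star hσ

end FaceRings

end StanleyReisner

theorem mainTheorem7 (k : Type*) [Field k] (V : Type*) [Finite V] [DecidableEq V]
    (K : PreAbstractSimplicialComplex V) :
    -- the `D(R)`-submodules of `R` are the `D(R)`-stable ideals
    (∀ S : Set (StanleyReisner.FaceRing k K),
      (∃ N : Submodule (StanleyReisner.diffOps k (StanleyReisner.FaceRing k K))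
          (StanleyReisner.FaceRing k K), (N : Set (StanleyReisner.FaceRing k K)) = S) ↔
        ∃ I : Ideal (StanleyReisner.FaceRing k K), StanleyReisner.IsDStable k I ∧
          (I : Set (StanleyReisner.FaceRing k K)) = S) ∧
    -- apart from `R` itself (the empty intersection), these are the ideals obtained from the
    -- `I_{st(σ)}` by sums and intersections
    (∀ I : Ideal (StanleyReisner.FaceRing k K), StanleyReisner.IsDStable k I ↔
      I = ⊤ ∨ I ∈ latticeClosure {J : Ideal (StanleyReisner.FaceRing k K) |
        ∃ σ : Finset V, StanleyReisner.IsFace K σ ∧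
          J = StanleyReisner.faceIdealIn k K (StanleyReisner.star K σ)}) ∧
    -- equivalently, the intersections of sums of minimal primes
    (∀ I : Ideal (StanleyReisner.FaceRing k K), StanleyReisner.IsDStable k I ↔
      ∃ F : Set (Set (Ideal (StanleyReisner.FaceRing k K))),
        (∀ P ∈ F, P.Nonempty ∧ P ⊆ minimalPrimes (StanleyReisner.FaceRing k K)) ∧
          I = ⨅ P ∈ F, sSup P) := by
  exact ⟨StanleyReisner.exists_submodule_coe_eq_iff,
    StanleyReisner.isDStable_iff_mem_latticeClosure,
    StanleyReisner.isDStable_iff_exists_biInf_sSup⟩
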